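/- \textbf{Game.} There are $n$ players, each with one packet, $k\ge 1$ channels and slots $t=1,2,\dots$. In every slot each pending player chooses an action in $\{0,1,\dots,k\}$: a channel to transmit on, or $0$ (no transmission). If she is the only player on her channel she is successful and leaves the game; otherwise she stays pending. Feedback is acknowledgement-based: a protocol prescribes, for each slot $t$ and each personal history (the player's own actions in slots $1,\dots,t-1$), a probability distribution on $\{0,\dots,k\}$ that a pending player with this history uses in slot $t$. The latency $T_i\in\{1,2,\dots\}\cup\{\infty\}$ of player $i$ is the slot of her successful transmission. A profile of protocols is an \emph{equilibrium} if for every player $i$, every time $t\ge 0$ and every personal history of length $t$ of $i$, no unilateral deviation of $i$ after time $t$ decreases the conditional expectation of $T_i$ given that $i$ is pending after slot $t$ with that history. An anonymous protocol (common to all players; it may depend on $n$ and $k$) is \emph{efficient} for $k$ channels if there are times $\tau(n)=\Theta(n/k)$ such that all players have been successful by time $\tau(n)$ with probability tending to $1$ as $n\to\infty$. \textbf{Protocol $g_1$} with parameter $\beta\in(0,1)$. Let $r=\lfloor -\tfrac12\log_\beta n\rfloor$, $n_j=\beta^j n/k$ for $1\le j\le r+1$, $l_j=\lfloor \tfrac{e}{\beta}n_j\rfloor$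 for $1\le j\le r$, $l_{r+1}=\lfloor n/k\rfloor$, and $t_0=1+\sum_{j=1}^{r+1}l_j$. The slots $1,\dots,t_0-1$ are partitioned into consecutive intervals $I_1,\dots,I_{r+1}$ of lengths $l_1,\dots,l_{r+1}$. In a slot of $I_j$ every pending player transmits with probability $1/\max\{n_j,k\}$ on each channel. In slot $t_0$ each pending player chooses a channel uniformly at random, transmits on it, and from then on always transmits on that same channel. \textbf{Lemma.} (1) For all $\beta\in(0,1)$, $k\ge1$ and $n\ge 2k+1$: if all $n$ players use $g_1$, this is an equilibrium, and the expected latency of every player is infinite. (2) For every $\beta\in(0,1)$ there are constants $c,C>0$, depending only on $\beta$, such that $c\,n/k\le t_0\le C\,n/k$ for all $k\ge1$ and $n\ge 2k+1$. (3) For every $k\ge 1$ there is $\beta_0\in(0,1)$ such that for every $\beta\in(\beta_0,1)$ the protocol $g_1$ is efficient for $k$ channels; more precisely, all players transmit successfully before the deadline $t_0$ with probability tending to $1$ as $n\to\infty$. -/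

import Mathlib

open MeasureTheory ProbabilityTheory Filter Topology
open scoped ENNReal

/-! # Contention games with acknowledgement-based feedback

There are `n` players and `k` channels.  An action is an element of `Fin (k + 1)`: the action `0`
means "no transmission", and the actions `a ≠ 0` are the `k` channels.  Time slots are
`t = 1, 2, …`; index `0` of a transmission sequence is a dummy slot in which nobody transmits. -/

namespace Contention

/-- An acknowledgement-based protocol for one player: `f t h` is the mixed strategy used in slot
`t + 1` by a pending player whose personal transmission history is `h`, where `h s` is her action
in slot `s + 1`, for `s < t`.  (A pending player's transmissions have all failed, so the history
contains all the feedback that she has received.) -/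
abbrev Protocol (k : ℕ) : Type := (t : ℕ) → (Fin t → Fin (k + 1)) → PMF (Fin (k + 1))

/-- A transmission sequence: `ω t i` is the action of player `i` in slot `t`. -/
abbrev Transmissions (n k : ℕ) : Type := ℕ → Fin n → Fin (k + 1)

/-- In the transmission vector `x`, player `i` transmits on some channel and nobody else uses
that channel. -/
def Succeeds {n k : ℕ} (x : Fin n → Fin (k + 1)) (i : Fin n) : Prop :=
  x i ≠ 0 ∧ ∀ j, j ≠ i → x j ≠ x i

open Classical in
/-- Given the transmission vectors of the slots up to `t`, the conditional law of the action of
player `i` in slot `t + 1`: she follows her protocol if she is still pending, and does not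
transmit any more if she has already been successful. -/
noncomputable def actionLaw {n k : ℕ} (f : Fin n → Protocol k) (t : ℕ)
    (x : (s : Finset.Iic t) → Fin n → Fin (k + 1)) (i : Fin n) : PMF (Fin (k + 1)) :=
  if ∃ s : Finset.Iic t, Succeeds (x s) i then PMF.pure 0
  else f i t (fun s => x ⟨s + 1, Finset.mem_Iic.mpr s.isLt⟩ i)

/-- The conditional law of the transmission vector of slot `t + 1`: the players randomize
independently. -/
noncomputable def stepKernel {n k : ℕ} (f : Fin n → Protocol k) (t : ℕ) :
    Kernel ((s : Finset.Iic t) → Fin n → Fin (k + 1)) (Fin n → Fin (k + 1)) :=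
  Kernel.ofFunOfCountable fun x => Measure.pi fun i => (actionLaw f t x i).toMeasure

instance {n k : ℕ} (f : Fin n → Protocol k) (t : ℕ) : IsMarkovKernel (stepKernel f t) :=
  ⟨fun x => by
    change IsProbabilityMeasure (Measure.pi fun i => (actionLaw f t x i).toMeasure)
    infer_instance⟩

/-- The law of the transmission sequence when player `i` follows the protocol `f i`, for all
`i` (Ionescu-Tulcea). -/
noncomputable def law {n k : ℕ} (f : Fin n → Protocol k) : Measure (Transmissions n k) :=
  Kernel.traj (X := fun _ => Fin n → Fin (k + 1)) (stepKernel f) 0 (fun _ _ => 0)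

/-- The latency `T_i`: the first slot in which player `i` transmits successfully, `⊤` if there is
none. -/
noncomputable def latency {n k : ℕ} (i : Fin n) (ω : Transmissions n k) : ℕ∞ :=
  ⨅ (t : ℕ) (_ : 1 ≤ t ∧ Succeeds (ω t) i), (t : ℕ∞)

/-- The finishing time `T = sup_i T_i`. -/
noncomputable def finishingTime {n k : ℕ} (ω : Transmissions n k) : ℕ∞ :=
  ⨆ i, latency i ω

/-- The (unconditional) expected latency of player `i`. -/
noncomputable def expectedLatency {n k : ℕ} (f : Fin n → Protocol k) (i : Fin n) : ℝ≥0∞ :=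
  ∫⁻ ω, (latency i ω : ℝ≥0∞) ∂(law f)

/-- The protocol that plays the actions `h 0, …, h (t - 1)` in the slots `1, …, t` and follows
`g` from slot `t + 1` on. -/
noncomputable def Protocol.after {k t : ℕ} (h : Fin t → Fin (k + 1)) (g : Protocol k) :
    Protocol k :=
  fun s hist => if hs : s < t then PMF.pure (h ⟨s, hs⟩) else g s hist

/-- The expected latency of player `i` given that she is pending after slot `t` with personal
history `h`, when she follows `f i` from slot `t + 1` on and the others follow `f` throughout.
The history is imposed on player `i` (this is the usual conditional expectation whenever `h` is
consistent with `f`, and makes sense also for histories that are off the path of her own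
protocol); we then condition on the event that she is pending. -/
noncomputable def expectedLatencyGiven {n k : ℕ} (f : Fin n → Protocol k) (i : Fin n) {t : ℕ}
    (h : Fin t → Fin (k + 1)) : ℝ≥0∞ :=
  ∫⁻ ω, (latency i ω : ℝ≥0∞)
    ∂(cond (law (Function.update f i (Protocol.after h (f i)))) {ω | (t : ℕ∞) < latency i ω})

/-- The profile `f` is an equilibrium: after no personal history can a pending player decrease
her expected latency by deviating unilaterally to some other protocol. -/
def IsEquilibrium {n k : ℕ} (f : Fin n → Protocol k) : Prop :=
  ∀ (i : Fin n) (t : ℕ) (h : Fin t → Fin (k + 1)) (g : Protocol k),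
    expectedLatencyGiven f i h ≤ expectedLatencyGiven (Function.update f i g) i h

/-- For `k` channels, the anonymous protocol `f` (which may depend on the number `n` of players,
known to everybody) is efficient: there are times `τ n = Θ(n / k)` such that all players have
successfully transmitted by time `τ n` with probability tending to `1` as `n → ∞`. -/
def IsEfficient (k : ℕ) (f : ℕ → Protocol k) : Prop :=
  ∃ τ : ℕ → ℕ, ((fun n => (τ n : ℝ)) =Θ[atTop] fun n => (n : ℝ) / k) ∧
    Tendsto (fun n => law (fun _ : Fin n => f n) {ω | finishingTime ω ≤ (τ n : ℕ∞)})
      atTop (𝓝 1)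

/-- The strategy that transmits with probability `1 / m` on each of the `k` channels, and does not
transmit with the remaining probability `1 - k / m`, for a real number `m ≥ k`. -/
noncomputable def channelStrategy (k : ℕ) (m : ℝ) (hm : (k : ℝ) ≤ m) : PMF (Fin (k + 1)) :=
  PMF.ofFintype
    (fun a => if a = 0 then 1 - k * ENNReal.ofReal (1 / m) else ENNReal.ofReal (1 / m)) (by
      have hk : (k : ℝ≥0∞) * ENNReal.ofReal (1 / m) ≤ 1 := by
        rw [← ENNReal.ofReal_natCast, ← ENNReal.ofReal_mul (Nat.cast_nonneg k),
          ← ENNReal.ofReal_one]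
        apply ENNReal.ofReal_le_ofReal
        rw [mul_one_div]
        exact div_le_one_of_le₀ hm ((Nat.cast_nonneg k).trans hm)
      rw [Fin.sum_univ_succ]
      simp only [Fin.succ_ne_zero, if_true, if_false, Finset.sum_const, Finset.card_univ,
        Fintype.card_fin, nsmul_eq_mul]
      exact tsub_add_cancel_of_le hk)

/-! ### The protocol `g₁`, with parameter `β ∈ (0, 1)` -/

/-- `n_j = β ^ j * n / k`. -/
noncomputable def estimate (β : ℝ) (k n j : ℕ) : ℝ := β ^ j * n / k

/-- The number `r`, the integer in `(-log_β n / 2 - 1, -log_β n / 2]`. -/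
noncomputable def numIntervals (β : ℝ) (n : ℕ) : ℕ := ⌊-Real.logb β n / 2⌋₊

/-- The length of the interval `I_j`: it is `⌊(e / β) * n_j⌋` for `1 ≤ j ≤ r`, and `⌊n / k⌋` for
`j = r + 1`. -/
noncomputable def intervalLength (β : ℝ) (k n j : ℕ) : ℕ :=
  if j ≤ numIntervals β n then ⌊Real.exp 1 / β * estimate β k n j⌋₊ else n / k

/-- The deadline `t₀ = 1 + ∑_{j = 1}^{r + 1} l_j`. -/
noncomputable def deadline (β : ℝ) (k n : ℕ) : ℕ :=
  1 + ∑ j ∈ Finset.Icc 1 (numIntervals β n + 1), intervalLength β k n j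

/-- The index `j` of the interval `I_j` that contains the slot `t`, for `1 ≤ t < t₀`: the least
`j` with `t ≤ l_1 + … + l_j`. -/
noncomputable def intervalIndex (β : ℝ) (k n t : ℕ) : ℕ :=
  sInf {j | t ≤ ∑ i ∈ Finset.Icc 1 j, intervalLength β k n i}

/-- The protocol `g₁`.  In a slot `t + 1 < t₀` of the interval `I_j`, transmit with probability
`1 / max {n_j, k}` on each channel.  In slot `t₀`, transmit on a uniformly random channel; in
every later slot, transmit on the channel that was chosen in slot `t₀`.  (The history in which
nothing was transmitted in slot `t₀` does not occur under the protocol; a random channel is then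
drawn.)  The action of slot `t₀` is the entry `t₀ - 1` of the history. -/
noncomputable def g₁ (β : ℝ) (k n : ℕ) : Protocol k := fun t h =>
  if t + 1 < deadline β k n then
    channelStrategy k (max (estimate β k n (intervalIndex β k n (t + 1))) k) (le_max_right _ _)
  else if ht : deadline β k n - 1 < t then
    if h ⟨deadline β k n - 1, ht⟩ = 0 then channelStrategy k k le_rfl
    else PMF.pure (h ⟨deadline β k n - 1, ht⟩)
  else channelStrategy k k le_rfl

end Contention

/-!
The profile in which all players use `g₁` is an equilibrium because nobody can achieve a finite
expected latency, whatever she does. For every player `i` there are at least `2 k` others, so they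
can be assigned to the channels in such a way that each channel gets two players different from `i`
(`Contention.exists_blocking`). With positive probability the others follow this assignment in each
of the finitely many slots up to the deadline, and from then on `g₁` repeats the action of the
deadline forever (`Contention.exists_measure_pos_blocking`). Then `i` is never successful, so all
conditional expected latencies, before and after a deviation, are infinite.

The deadline is `Θ(n / k)` because the interval lengths are bounded by a geometric series and the
last one is `⌊n / k⌋` (`Contention.deadline_bounds`).

For the efficiency, the number `N` of pending players is shown to be at most `β ^ j n` after the
interval `I_j`, for all `j ≤ r`, with high probability. While `β ^ (j + 1) n < N ≤ β ^ j n` in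
`I_{j+1}`, the expected number of transmissions on a given channel lies between `k` and
`k / β ≤ 2 k`, so a slot is successful with probability at least `exp (-4 k)`. The interval has at
least `2 β ^ (j + 1) n / k - 1` slots, but only `(1 - β) β ^ j n` successes are needed, which is
a small fraction of the expected number if `β` is close to `1`. The deviation bound comes from the
potential `exp N`, which shrinks geometrically in expectation until the target is reached
(`Contention.measure_interval_le`). As `β ^ r n ≥ √n`, the error probabilities are exponentially
small in `√n` and there are only `O(log n)` of them. In the last interval `N` is of order `√n` and
every pending player succeeds with probability of order `1 / √n` in each of the `⌊n / k⌋` slots, so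
the expectation of `N` tends to zero (`Contention.measure_last_interval_le`). Both bounds are
instances of one drift inequality, `Contention.measure_le_of_drift`, which rests on the Markov
property `Contention.lintegral_law_succ` of the transmission sequence and on the probability
`m p (1 - p) ^ (m - 1)` that exactly one of `m` players uses a channel.
-/

namespace Contention

/-! ### The law of the transmission sequence, slot by slot -/

instance {n k : ℕ} (f : Fin n → Protocol k) : IsProbabilityMeasure (law f) := by
  unfold law; infer_instance

/-- The Markov property of the transmission sequence: given the slots up to `t`, the transmission
vector of slot `t + 1` is distributed according to `stepKernel f t`. -/
theorem lintegral_law_succ {n k : ℕ} (f : Fin n → Protocol k) (t : ℕ)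
    (G : ((s : Finset.Iic t) → Fin n → Fin (k + 1)) → (Fin n → Fin (k + 1)) → ℝ≥0∞) :
    ∫⁻ ω, G (Preorder.frestrictLe t ω) (ω (t + 1)) ∂law f =
      ∫⁻ ω, ∫⁻ y, G (Preorder.frestrictLe t ω) y ∂stepKernel f t (Preorder.frestrictLe t ω)
        ∂law f := by
  have hmap : ∀ b, (law f).map (Preorder.frestrictLe b) =
      Kernel.partialTraj (X := fun _ => Fin n → Fin (k + 1)) (stepKernel f) 0 b (fun _ _ => 0) :=
    fun b => Kernel.traj_map_frestrictLe_apply 0 b _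
  have hL : ∫⁻ ω, G (Preorder.frestrictLe t ω) (ω (t + 1)) ∂law f =
      ∫⁻ z, G (Preorder.frestrictLe₂ (π := fun _ => Fin n → Fin (k + 1)) t.le_succ z)
        (z ⟨t + 1, Finset.mem_Iic.2 le_rfl⟩)
        ∂((law f).map (Preorder.frestrictLe (t + 1))) := by
    rw [lintegral_map (Measurable.of_discrete) (by fun_prop)]
    rfl
  have hR : ∫⁻ ω, ∫⁻ y, G (Preorder.frestrictLe t ω) y
      ∂stepKernel f t (Preorder.frestrictLe t ω) ∂law f =
      ∫⁻ x, ∫⁻ y, G x y ∂stepKernel f t x ∂((law f).map (Preorder.frestrictLe t)) := by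
    rw [lintegral_map (Measurable.of_discrete) (by fun_prop)]
  rw [hL, hR, hmap, hmap, Kernel.partialTraj_succ_eq_comp (zero_le),
    Kernel.lintegral_comp _ _ _ (Measurable.of_discrete)]
  refine lintegral_congr fun x => ?_
  rw [Kernel.partialTraj_succ_self, Kernel.lintegral_map _ (by fun_prop) _ (Measurable.of_discrete),
    Kernel.lintegral_id_prod (Measurable.of_discrete),
    Kernel.lintegral_map _ (by fun_prop) _ (Measurable.of_discrete)]
  refine lintegral_congr fun y => ?_
  congr 1
  · ext i : 1
    simp [IicProdIoc, Finset.mem_Iic.1 i.2]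
  · simp [IicProdIoc, MeasurableEquiv.piSingleton]

theorem ae_law_zero {n k : ℕ} (f : Fin n → Protocol k) : ∀ᵐ ω ∂law f, ω 0 = fun _ => 0 := by
  have hmap : (law f).map (Preorder.frestrictLe 0) =
      Kernel.partialTraj (X := fun _ => Fin n → Fin (k + 1)) (stepKernel f) 0 0 (fun _ _ => 0) :=
    Kernel.traj_map_frestrictLe_apply 0 0 _
  have h : ∀ᵐ x ∂((law f).map (Preorder.frestrictLe 0)),
      x = fun _ _ => 0 := by
    rw [hmap, Kernel.partialTraj_self, Kernel.id_apply, ae_dirac_eq]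
    rfl
  have h2 := ae_of_ae_map (by fun_prop) h
  filter_upwards [h2] with ω hω
  exact congrFun hω ⟨0, by simp⟩

/-- If after every history in `A` the transmission vector of slot `t + 1` lies in `B` with
probability at least `q`, then `A` is followed by `B` with probability at least `q P(A)`. -/
theorem measure_law_inter {n k : ℕ} (f : Fin n → Protocol k) (t : ℕ)
    (A : Set ((s : Finset.Iic t) → Fin n → Fin (k + 1))) (B : Set (Fin n → Fin (k + 1)))
    (q : ℝ≥0∞) (hq : ∀ x ∈ A, q ≤ stepKernel f t x B) :
    q * law f {ω | Preorder.frestrictLe t ω ∈ A} ≤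
      law f {ω | Preorder.frestrictLe t ω ∈ A ∧ ω (t + 1) ∈ B} := by
  classical
  have hm : MeasurableSet {ω : Transmissions n k | Preorder.frestrictLe t ω ∈ A} :=
    (Preorder.measurable_frestrictLe t) (MeasurableSet.of_discrete (s := A))
  have hm' : MeasurableSet {ω : Transmissions n k | ω (t + 1) ∈ B} :=
    (measurable_pi_apply (t + 1)) (MeasurableSet.of_discrete (s := B))
  have key := lintegral_law_succ f t (fun x y => A.indicator 1 x * B.indicator 1 y)
  have hL : ∫⁻ ω, A.indicator 1 (Preorder.frestrictLe t ω) * B.indicator 1 (ω (t + 1)) ∂law f =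
      law f {ω | Preorder.frestrictLe t ω ∈ A ∧ ω (t + 1) ∈ B} := by
    refine Eq.trans ?_ (lintegral_indicator_one (μ := law f) (hm.inter hm'))
    refine lintegral_congr fun ω => ?_
    by_cases h1 : Preorder.frestrictLe t ω ∈ A <;> by_cases h2 : ω (t + 1) ∈ B <;>
      simp [h1, h2]
  rw [← hL, key, ← lintegral_indicator_one hm, ← lintegral_const_mul _ (measurable_one.indicator hm)]
  refine lintegral_mono fun ω => ?_
  by_cases h1 : Preorder.frestrictLe t ω ∈ A
  · simpa [h1, lintegral_indicator_one (MeasurableSet.of_discrete (s := B))] using hq _ h1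
  · simp [h1]

/-! ### Blocking all channels forever -/

theorem channelStrategy_apply_of_ne_zero {k : ℕ} {m : ℝ} (hm : (k : ℝ) ≤ m) {a : Fin (k + 1)}
    (ha : a ≠ 0) : channelStrategy k m hm a = ENNReal.ofReal (1 / m) := by
  simp [channelStrategy, ha]

theorem channelStrategy_pos {k : ℕ} (hk : 1 ≤ k) {m : ℝ} (hm : (k : ℝ) ≤ m) {a : Fin (k + 1)}
    (ha : a ≠ 0) : 0 < channelStrategy k m hm a := by
  rw [channelStrategy_apply_of_ne_zero hm ha, ENNReal.ofReal_pos]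
  have : (1 : ℝ) ≤ k := by exact_mod_cast hk
  have : 0 < m := by linarith
  positivity

theorem one_le_deadline (β : ℝ) (k n : ℕ) : 1 ≤ deadline β k n := by
  unfold deadline; omega

theorem stepKernel_pi {n k : ℕ} (f : Fin n → Protocol k) (t : ℕ)
    (x : (s : Finset.Iic t) → Fin n → Fin (k + 1)) (B : Fin n → Set (Fin (k + 1))) :
    stepKernel f t x (Set.univ.pi B) = ∏ i, (actionLaw f t x i).toMeasure (B i) := by
  change Measure.pi _ _ = _
  rw [Measure.pi_pi]

/-- Two players per channel can be chosen among the `n - 1 ≥ 2 k` players other than `i`: a channel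
assignment in which every channel is used by two players different from `i`. -/
theorem exists_blocking {n k : ℕ} (hk : 1 ≤ k) (hn : 2 * k + 1 ≤ n) (i : Fin n) :
    ∃ c : Fin n → Fin (k + 1), (∀ j, c j ≠ 0) ∧
      ∀ a, a ≠ 0 → ∀ j, ∃ j', j' ≠ i ∧ j' ≠ j ∧ c j' = a := by
  -- After exchanging `i` with player `2 k`, the players `a - 1` and `a - 1 + k` go to channel `a`.
  let σ : Equiv.Perm (Fin n) := Equiv.swap i ⟨2 * k, by omega⟩
  refine ⟨fun j => ⟨(σ j : ℕ) % k + 1, by have := Nat.mod_lt (σ j : ℕ) hk; omega⟩,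
    fun j h => by simp [Fin.ext_iff] at h, fun a ha j => ?_⟩
  have ha' : 1 ≤ (a : ℕ) := by
    rcases Nat.eq_zero_or_pos (a : ℕ) with h | h
    · exact absurd (Fin.ext h) ha
    · exact h
  have hak := a.isLt
  have hσ : ∀ m : Fin n, (m : ℕ) < 2 * k → σ.symm m ≠ i := by
    intro m hm h
    rw [Equiv.symm_apply_eq] at h
    simp only [σ, Equiv.swap_apply_left] at h
    rw [h] at hm
    simp at hm
  let m₁ : Fin n := ⟨a - 1, by omega⟩
  let m₂ : Fin n := ⟨a - 1 + k, by omega⟩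
  have h12 : m₁ ≠ m₂ := by simp [m₁, m₂]; omega
  have hmod : ((a : ℕ) - 1) % k = a - 1 := Nat.mod_eq_of_lt (by omega)
  by_cases hj : σ.symm m₁ = j
  · refine ⟨σ.symm m₂, hσ _ (by simp [m₂]; omega), ?_, ?_⟩
    · rw [← hj]; exact fun h => h12 (σ.symm.injective h).symm
    · apply Fin.ext
      simp [m₂, hmod]
      omega
  · refine ⟨σ.symm m₁, hσ _ (by simp [m₁]; omega), hj, ?_⟩
    apply Fin.ext
    simp [m₁, hmod]
    omega

/-- If the players other than `i` use `g₁` and have so far been in accordance with the blocking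
assignment `c`, then they stick to it in the next slot with a probability that is bounded below,
and with probability one after the deadline. -/
theorem exists_le_stepKernel_blocking {n k : ℕ} {β : ℝ} (hk : 1 ≤ k) {i : Fin n}
    {f : Fin n → Protocol k} (hf : ∀ j, j ≠ i → f j = g₁ β k n)
    {c : Fin n → Fin (k + 1)} (hc0 : ∀ j, c j ≠ 0)
    (hc : ∀ a, a ≠ 0 → ∀ j, ∃ j', j' ≠ i ∧ j' ≠ j ∧ c j' = a) (t : ℕ) :
    ∃ q : ℝ≥0∞, 0 < q ∧ (deadline β k n ≤ t → q = 1) ∧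
      ∀ x : (s : Finset.Iic t) → Fin n → Fin (k + 1),
        (∀ j, x ⟨0, by simp⟩ j = 0) →
        (∀ s : Finset.Iic t, 1 ≤ (s : ℕ) → ∀ j, j ≠ i → x s j = c j) →
        q ≤ stepKernel f t x {y | ∀ j, j ≠ i → y j = c j} := by
  classical
  have hD := one_le_deadline β k n
  let b : Fin n → ℝ≥0∞ := fun j =>
    if j = i then 1
    else if t + 1 < deadline β k n then
      channelStrategy k (max (estimate β k n (intervalIndex β k n (t + 1))) k)
        (le_max_right _ _) (c j)
    else if deadline β k n ≤ t then 1 else channelStrategy k k le_rfl (c j)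
  refine ⟨∏ j, b j, ?_, fun ht => ?_, fun x hx0 hx => ?_⟩
  · rw [pos_iff_ne_zero, Finset.prod_ne_zero_iff]
    intro j _
    simp only [b]
    split_ifs
    · exact one_ne_zero
    · exact (channelStrategy_pos hk _ (hc0 j)).ne'
    · exact one_ne_zero
    · exact (channelStrategy_pos hk _ (hc0 j)).ne'
  · refine Finset.prod_eq_one fun j _ => ?_
    simp only [b]
    split_ifs
    · rfl
    · omega
    · rfl
  · have hset : {y : Fin n → Fin (k + 1) | ∀ j, j ≠ i → y j = c j} =
        Set.univ.pi (fun j => if j = i then Set.univ else {c j}) := by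
      ext y
      simp only [Set.mem_ofPred_eq, Set.mem_univ_pi]
      refine forall_congr' fun j => ?_
      by_cases hj : j = i <;> simp [hj]
    rw [hset, stepKernel_pi]
    refine Finset.prod_le_prod' fun j _ => ?_
    by_cases hj : j = i
    · simp [b, hj]
    have hns : ¬ ∃ s : Finset.Iic t, Succeeds (x s) j := by
      rintro ⟨s, hs0, hs⟩
      rcases Nat.eq_zero_or_pos (s : ℕ) with h | h
      · have : s = ⟨0, by simp⟩ := Subtype.ext h
        exact hs0 (this ▸ hx0 j)
      · obtain ⟨j', hj'i, hj'j, hj'c⟩ := hc (c j) (hc0 j) j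
        exact hs j' hj'j (by rw [hx s h j hj, hx s h j' hj'i, hj'c])
    simp only [actionLaw, hns, hj, if_false, hf j hj, b]
    rw [PMF.toMeasure_apply_singleton _ _ (MeasurableSet.singleton _)]
    unfold g₁
    by_cases h1 : t + 1 < deadline β k n
    · simp [h1]
    by_cases h2 : deadline β k n ≤ t
    · have h3 : deadline β k n - 1 < t := by omega
      have h4 : x ⟨deadline β k n - 1 + 1, Finset.mem_Iic.mpr h3⟩ j = c j :=
        hx _ (by simp) j hj
      simp [h1, h2, h3, h4, hc0 j]
    · have h3 : ¬ deadline β k n - 1 < t := by omega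
      simp [h1, h2, h3]

/-- With positive probability the players other than `i`, if they use `g₁`, block all channels
forever, whatever player `i` does. -/
theorem exists_measure_pos_blocking {n k : ℕ} {β : ℝ} (hk : 1 ≤ k) (hn : 2 * k + 1 ≤ n) (i : Fin n)
    {f : Fin n → Protocol k} (hf : ∀ j, j ≠ i → f j = g₁ β k n) :
    ∃ J : Set (Transmissions n k), MeasurableSet J ∧ 0 < law f J ∧ ∀ ω ∈ J, latency i ω = ⊤ := by
  obtain ⟨c, hc0, hc⟩ := exists_blocking hk hn i
  let A : (t : ℕ) → Set ((s : Finset.Iic t) → Fin n → Fin (k + 1)) := fun t =>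
    {x | (∀ j, x ⟨0, by simp⟩ j = 0) ∧
      ∀ s : Finset.Iic t, 1 ≤ (s : ℕ) → ∀ j, j ≠ i → x s j = c j}
  let J : ℕ → Set (Transmissions n k) := fun t => {ω | Preorder.frestrictLe t ω ∈ A t}
  have hJm : ∀ t, MeasurableSet (J t) := fun t =>
    (Preorder.measurable_frestrictLe t) (MeasurableSet.of_discrete (s := A t))
  have hJ : ∀ t ω, ω ∈ J t ↔ (∀ j, ω 0 j = 0) ∧ ∀ s ≤ t, 1 ≤ s → ∀ j, j ≠ i → ω s j = c j := by
    intro t ω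
    simp [J, A]
  have hstep : ∀ t, ∃ q : ℝ≥0∞, 0 < q ∧ (deadline β k n ≤ t → q = 1) ∧
      q * law f (J t) ≤ law f (J (t + 1)) := by
    intro t
    obtain ⟨q, hq, hq1, hle⟩ := exists_le_stepKernel_blocking hk hf hc0 hc t
    refine ⟨q, hq, hq1, (measure_law_inter f t (A t) _ q fun x hx => hle x hx.1 hx.2).trans ?_⟩
    refine measure_mono ?_
    rintro ω ⟨h1, h2⟩
    have h1' := (hJ t ω).1 h1
    refine (hJ _ ω).2 ⟨h1'.1, fun s hs hs1 j hj => ?_⟩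
    rcases Nat.lt_or_ge t s with h | h
    · obtain rfl : s = t + 1 := by omega
      exact h2 j hj
    · exact h1'.2 s h hs1 j hj
  have hpos : ∀ t, 0 < law f (J t) := by
    intro t
    induction t with
    | zero =>
      have : law f (J 0) = 1 := by
        rw [prob_compl_eq_zero_iff (hJm 0) |>.symm]
        filter_upwards [ae_law_zero f] with ω hω
        exact (hJ 0 ω).2 ⟨fun j => by simp [hω], fun s hs hs1 => by omega⟩
      simp [this]
    | succ t ih =>
      obtain ⟨q, hq, -, hle⟩ := hstep t
      exact (ENNReal.mul_pos hq.ne' ih.ne').trans_le hle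
  have hanti : Antitone J := by
    intro t t' htt' ω hω
    have := (hJ _ _).1 hω
    exact (hJ _ _).2 ⟨this.1, fun s hs => this.2 s (hs.trans htt')⟩
  have hge : ∀ t, law f (J (deadline β k n)) ≤ law f (J t) := by
    intro t
    rcases le_total t (deadline β k n) with h | h
    · exact measure_mono (hanti h)
    · induction t, h using Nat.le_induction with
      | base => exact le_rfl
      | succ t ht ih =>
        obtain ⟨q, -, hq1, hle⟩ := hstep t
        rw [hq1 ht, one_mul] at hle
        exact ih.trans hle
  refine ⟨⋂ t, J t, MeasurableSet.iInter hJm, ?_, fun ω hω => ?_⟩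
  · rw [hanti.measure_iInter (fun t => (hJm t).nullMeasurableSet) ⟨0, measure_ne_top _ _⟩]
    exact (hpos _).trans_le (le_iInf hge)
  · have hω' : ∀ t, 1 ≤ t → ∀ j, j ≠ i → ω t j = c j := fun t ht =>
      ((hJ t ω).1 (Set.mem_iInter.1 hω t)).2 t le_rfl ht
    simp only [latency, iInf_eq_top]
    rintro t ⟨ht, h0, hs⟩
    obtain ⟨j, hji, -, hj⟩ := hc (ω t i) h0 i
    exact absurd ((hω' t ht j hji).trans hj) (hs j hji)

theorem setLIntegral_latency_eq_top {n k : ℕ} {μ : Measure (Transmissions n k)} {i : Fin n}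
    {J S : Set (Transmissions n k)} (hJm : MeasurableSet J) (hJ : 0 < μ J)
    (h : ∀ ω ∈ J, latency i ω = ⊤) (hJS : J ⊆ S) :
    ∫⁻ ω in S, (latency i ω : ℝ≥0∞) ∂μ = ⊤ := by
  rw [eq_top_iff]
  calc (⊤ : ℝ≥0∞) = ∫⁻ _ in J, ⊤ ∂μ := by simp [ENNReal.top_mul hJ.ne']
    _ ≤ ∫⁻ ω in J, (latency i ω : ℝ≥0∞) ∂μ := by
      refine setLIntegral_mono' hJm fun ω hω => ?_
      simp [h ω hω]
    _ ≤ _ := lintegral_mono_set hJS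

theorem expectedLatency_eq_top {n k : ℕ} {β : ℝ} (hk : 1 ≤ k) (hn : 2 * k + 1 ≤ n) (i : Fin n) :
    expectedLatency (fun _ : Fin n => g₁ β k n) i = ⊤ := by
  obtain ⟨J, hJm, hJ, hJt⟩ := exists_measure_pos_blocking (β := β) hk hn i
    (f := fun _ => g₁ β k n) (fun _ _ => rfl)
  have := setLIntegral_latency_eq_top hJm hJ hJt (Set.subset_univ J)
  rwa [setLIntegral_univ] at this

/-- After every history and every deviation the conditional expected latency is infinite, because
the other players block all channels forever with positive probability. -/
theorem expectedLatencyGiven_eq_top {n k : ℕ} {β : ℝ} (hk : 1 ≤ k) (hn : 2 * k + 1 ≤ n) {i : Fin n}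
    {f : Fin n → Protocol k} (hf : ∀ j, j ≠ i → f j = g₁ β k n) {t : ℕ}
    (h : Fin t → Fin (k + 1)) : expectedLatencyGiven f i h = ⊤ := by
  obtain ⟨J, hJm, hJ, hJt⟩ := exists_measure_pos_blocking hk hn i
    (f := Function.update f i (Protocol.after h (f i)))
    (fun j hj => by rw [Function.update_of_ne hj, hf j hj])
  have hJS : J ⊆ {ω | (t : ℕ∞) < latency i ω} := fun ω hω => by simp [hJt ω hω]
  rw [expectedLatencyGiven, ProbabilityTheory.cond, lintegral_smul_measure,
    setLIntegral_latency_eq_top hJm hJ hJt hJS, smul_eq_mul, ENNReal.mul_top]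
  exact ENNReal.inv_ne_zero.2 (measure_ne_top _ _)

theorem isEquilibrium_g₁ {n k : ℕ} {β : ℝ} (hk : 1 ≤ k) (hn : 2 * k + 1 ≤ n) :
    IsEquilibrium (fun _ : Fin n => g₁ β k n) := by
  intro i t h g
  rw [expectedLatencyGiven_eq_top hk hn (i := i)
    (f := Function.update (fun _ : Fin n => g₁ β k n) i g)
    (fun j hj => by rw [Function.update_of_ne hj])]
  exact le_top

/-! ### The number of pending players -/

open Classical in
/-- The set of players that are pending after slot `t`, given the transmission vectors of the
slots up to `t`. -/
noncomputable def pendingSet {n k t : ℕ} (x : (s : Finset.Iic t) → Fin n → Fin (k + 1)) :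
    Finset (Fin n) :=
  Finset.univ.filter fun i => ¬ ∃ s : Finset.Iic t, Succeeds (x s) i

/-- The number of players that are pending after slot `t`. -/
noncomputable def numPending {n k : ℕ} (t : ℕ) (ω : Transmissions n k) : ℕ :=
  (pendingSet (Preorder.frestrictLe (π := fun _ => Fin n → Fin (k + 1)) t ω)).card

theorem mem_pendingSet {n k t : ℕ} {x : (s : Finset.Iic t) → Fin n → Fin (k + 1)} {i : Fin n} :
    i ∈ pendingSet x ↔ ¬ ∃ s : Finset.Iic t, Succeeds (x s) i := by
  simp [pendingSet]

open Classical in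
theorem pendingSet_succ {n k : ℕ} (t : ℕ) (ω : Transmissions n k) :
    pendingSet (Preorder.frestrictLe (π := fun _ => Fin n → Fin (k + 1)) (t + 1) ω) =
      (pendingSet (Preorder.frestrictLe (π := fun _ => Fin n → Fin (k + 1)) t ω)).filter
        fun i => ¬ Succeeds (ω (t + 1)) i := by
  ext i
  simp only [Finset.mem_filter, mem_pendingSet, Preorder.frestrictLe_apply, Subtype.exists,
    Finset.mem_Iic, exists_prop]
  constructor
  · intro h
    exact ⟨fun ⟨s, hs, h'⟩ => h ⟨s, by omega, h'⟩, fun h' => h ⟨t + 1, le_rfl, h'⟩⟩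
  · rintro ⟨h1, h2⟩ ⟨s, hs, h'⟩
    rcases Nat.lt_or_ge t s with hts | hts
    · obtain rfl : s = t + 1 := by omega
      exact h2 h'
    · exact h1 ⟨s, hts, h'⟩

theorem numPending_antitone {n k : ℕ} (ω : Transmissions n k) :
    Antitone fun t => numPending t ω := by
  classical
  refine antitone_nat_of_succ_le fun t => ?_
  rw [numPending, numPending, pendingSet_succ]
  exact Finset.card_filter_le _ _

theorem numPending_le {n k : ℕ} (t : ℕ) (ω : Transmissions n k) : numPending t ω ≤ n :=
  (Finset.card_le_univ _).trans (by simp)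

theorem measurable_numPending {n k : ℕ} (t : ℕ) :
    Measurable (numPending (n := n) (k := k) t) :=
  (Measurable.of_discrete (f := fun x : (s : Finset.Iic t) → Fin n → Fin (k + 1) =>
    (pendingSet x).card)).comp (Preorder.measurable_frestrictLe t)

/-- If in slot `t + 1` every pending player transmits on channel `a` with probability `p`, then
with probability at least `m p (1 - p) ^ (m - 1)`, where `m` is the number of pending players, one
of them is successful on channel `a`. -/
theorem le_stepKernel_exists_succeeds {n k : ℕ} (f : Fin n → Protocol k) (t : ℕ)
    {a : Fin (k + 1)} (ha : a ≠ 0) {p : ℝ} (hp0 : 0 ≤ p) (hp1 : p ≤ 1)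
    (hf : ∀ i h, f i t h a = ENNReal.ofReal p)
    (x : (s : Finset.Iic t) → Fin n → Fin (k + 1)) :
    ENNReal.ofReal ((pendingSet x).card * p * (1 - p) ^ ((pendingSet x).card - 1)) ≤
      stepKernel f t x {y | ∃ i ∈ pendingSet x, Succeeds y i} := by
  classical
  -- `E i` is the event that `i` is the only player on channel `a`.
  let E : Fin n → Set (Fin n → Fin (k + 1)) := fun i =>
    Set.univ.pi fun j => if j = i then {a} else {a}ᶜ
  have hE : ∀ i y, y ∈ E i ↔ y i = a ∧ ∀ j, j ≠ i → y j ≠ a := by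
    intro i y
    simp only [E, Set.mem_univ_pi]
    constructor
    · intro h
      exact ⟨by simpa using h i, fun j hj => by simpa [hj] using h j⟩
    · rintro ⟨h1, h2⟩ j
      by_cases hj : j = i
      · simp [hj, h1]
      · simp [hj, h2 j hj]
  have hE1 : ∀ i ∈ pendingSet x, stepKernel f t x (E i) =
      ENNReal.ofReal (p * (1 - p) ^ ((pendingSet x).card - 1)) := by
    intro i hi
    have hfac : ∀ j, (actionLaw f t x j).toMeasure (if j = i then {a} else {a}ᶜ) =
        if j = i then ENNReal.ofReal p
        else if j ∈ pendingSet x then ENNReal.ofReal (1 - p) else 1 := by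
      intro j
      by_cases hj : j ∈ pendingSet x
      · have hlaw : (actionLaw f t x j).toMeasure {a} = ENNReal.ofReal p := by
          rw [PMF.toMeasure_apply_singleton _ _ (MeasurableSet.singleton _)]
          simp [actionLaw, mem_pendingSet.1 hj, hf]
        by_cases hji : j = i
        · simp only [hji, if_true]
          exact hji ▸ hlaw
        · simp only [hji, hj, if_false, if_true]
          rw [prob_compl_eq_one_sub (MeasurableSet.singleton _), hlaw,
            ENNReal.ofReal_sub _ hp0, ENNReal.ofReal_one]
      · have hji : j ≠ i := fun h => hj (h ▸ hi)
        have hlaw : (actionLaw f t x j).toMeasure {a} = 0 := by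
          rw [PMF.toMeasure_apply_singleton _ _ (MeasurableSet.singleton _)]
          have : ∃ s : Finset.Iic t, Succeeds (x s) j := by
            by_contra h
            exact hj (mem_pendingSet.2 h)
          simp [actionLaw, this, ha]
        simp only [hji, hj, if_false]
        rw [prob_compl_eq_one_sub (MeasurableSet.singleton _), hlaw, tsub_zero]
    rw [stepKernel_pi, Finset.prod_congr rfl fun j _ => hfac j,
      ← Finset.mul_prod_erase _ _ (Finset.mem_univ i), if_pos rfl,
      ENNReal.ofReal_mul hp0, ENNReal.ofReal_pow (by linarith)]
    congr 1
    rw [Finset.prod_congr rfl (g := fun j => if j ∈ pendingSet x then ENNReal.ofReal (1 - p) else 1)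
      (fun j hj => if_neg (Finset.ne_of_mem_erase hj)), Finset.prod_ite, Finset.prod_const_one,
      mul_one, Finset.prod_const, ← Finset.card_erase_of_mem hi]
    congr 2
    ext j
    simp [and_comm]
  have hdisj : (pendingSet x : Set (Fin n)).PairwiseDisjoint E := by
    intro i _ j _ hij
    refine Set.disjoint_left.2 fun y hyi hyj => ?_
    exact ((hE i y).1 hyi).2 j hij.symm ((hE j y).1 hyj).1
  calc _ = ∑ i ∈ pendingSet x, stepKernel f t x (E i) := by
        rw [Finset.sum_congr rfl hE1, Finset.sum_const, nsmul_eq_mul, mul_assoc,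
          ENNReal.ofReal_mul (by positivity), ENNReal.ofReal_natCast]
    _ = stepKernel f t x (⋃ i ∈ pendingSet x, E i) :=
        (measure_biUnion_finset hdisj fun _ _ => MeasurableSet.of_discrete).symm
    _ ≤ _ := by
        refine measure_mono fun y hy => ?_
        obtain ⟨i, hi, hy⟩ := Set.mem_iUnion₂.1 hy
        obtain ⟨h1, h2⟩ := (hE i y).1 hy
        exact ⟨i, hi, by rw [h1]; exact ha, fun j hj => by rw [h1]; exact h2 j hj⟩

open Classical in
/-- The drift of a monotone function `φ` of the number of pending players in one slot: with
probability at least `m p (1 - p) ^ (m - 1)` the number `m` of pending players decreases. -/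
theorem lintegral_stepKernel_le {n k : ℕ} (f : Fin n → Protocol k) (t : ℕ)
    {a : Fin (k + 1)} (ha : a ≠ 0) {p : ℝ} (hp0 : 0 ≤ p) (hp1 : p ≤ 1)
    (hf : ∀ i h, f i t h a = ENNReal.ofReal p)
    {φ : ℕ → ℝ} (hφ : Monotone φ) (hφ0 : ∀ m, 0 ≤ φ m)
    (x : (s : Finset.Iic t) → Fin n → Fin (k + 1)) {m : ℕ} (hm : (pendingSet x).card = m) :
    ∫⁻ y, ENNReal.ofReal (φ ((pendingSet x).filter fun i => ¬ Succeeds y i).card)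
        ∂stepKernel f t x ≤
      ENNReal.ofReal (φ m - m * p * (1 - p) ^ (m - 1) * (φ m - φ (m - 1))) := by
  have hp1' : 0 ≤ 1 - p := by linarith
  have hdrop : 0 ≤ φ m - φ (m - 1) := sub_nonneg.2 (hφ (Nat.sub_le _ _))
  set Q : ℝ := m * p * (1 - p) ^ (m - 1) with hQ
  have hQ0 : 0 ≤ Q := by positivity
  let B : Set (Fin n → Fin (k + 1)) := {y | ∃ i ∈ pendingSet x, Succeeds y i}
  have hB : ENNReal.ofReal Q ≤ stepKernel f t x B := by
    have := le_stepKernel_exists_succeeds f t ha hp0 hp1 hf x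
    rwa [hm] at this
  have hpt : ∀ y, ENNReal.ofReal (φ ((pendingSet x).filter fun i => ¬ Succeeds y i).card) +
      B.indicator (fun _ => ENNReal.ofReal (φ m - φ (m - 1))) y ≤ ENNReal.ofReal (φ m) := by
    intro y
    by_cases hy : y ∈ B
    · rw [Set.indicator_of_mem hy, ← ENNReal.ofReal_add (hφ0 _) hdrop]
      refine ENNReal.ofReal_le_ofReal ?_
      obtain ⟨i, hi, hs⟩ := hy
      have hlt : ((pendingSet x).filter fun i => ¬ Succeeds y i).card < m := by
        rw [← hm]
        exact Finset.card_lt_card (Finset.filter_ssubset.2 ⟨i, hi, not_not.2 hs⟩)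
      have := hφ (show ((pendingSet x).filter fun i => ¬ Succeeds y i).card ≤ m - 1 by omega)
      linarith
    · rw [Set.indicator_of_notMem hy, add_zero]
      refine ENNReal.ofReal_le_ofReal (hφ ?_)
      rw [← hm]
      exact Finset.card_filter_le _ _
  have hint := lintegral_mono (μ := stepKernel f t x) hpt
  rw [lintegral_add_left Measurable.of_discrete,
    lintegral_indicator_const MeasurableSet.of_discrete, lintegral_const, measure_univ,
    mul_one] at hint
  have hcancel : ENNReal.ofReal (φ m) ≤ ENNReal.ofReal (φ m - Q * (φ m - φ (m - 1))) +
      ENNReal.ofReal (φ m - φ (m - 1)) * ENNReal.ofReal Q := by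
    rw [← ENNReal.ofReal_mul hdrop]
    refine le_trans (ENNReal.ofReal_le_ofReal ?_) ENNReal.ofReal_add_le
    linarith
  have h3 := (add_le_add_right (mul_le_mul_right hB (ENNReal.ofReal (φ m - φ (m - 1)))) _).trans
    (hint.trans hcancel)
  exact (ENNReal.add_le_add_iff_right
    (ENNReal.mul_ne_top ENNReal.ofReal_ne_top ENNReal.ofReal_ne_top)).1 h3

/-- Let `p` be the probability of a transmission on some channel in the slots `s + 1, …, s + l`.
If the function `φ` of the number of pending players decreases in expectation by the factor `ρ` in
every slot, as long as at most `M` players are pending, then Markov's inequality bounds the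
probability that at most `M` players are pending after slot `s` and that the number of pending
players after slot `s + l` is one of those on which `φ ≥ c`. -/
theorem measure_le_of_drift {n k : ℕ} (f : Fin n → Protocol k) (s l : ℕ)
    {a : Fin (k + 1)} (ha : a ≠ 0) {p : ℝ} (hp0 : 0 ≤ p) (hp1 : p ≤ 1)
    (hf : ∀ t, s ≤ t → t < s + l → ∀ i h, f i t h a = ENNReal.ofReal p)
    {φ : ℕ → ℝ} (hφ : Monotone φ) (hφ0 : ∀ m, 0 ≤ φ m) {M ρ C c : ℝ} (hρ : 0 ≤ ρ)
    (hdrift : ∀ m : ℕ, (m : ℝ) ≤ M →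
      φ m - m * p * (1 - p) ^ (m - 1) * (φ m - φ (m - 1)) ≤ ρ * φ m)
    (hC : ∀ m : ℕ, (m : ℝ) ≤ M → φ m ≤ C) (hc : 0 < c) :
    law f {ω | (numPending s ω : ℝ) ≤ M ∧ c ≤ φ (numPending (s + l) ω)} ≤
      ENNReal.ofReal (ρ ^ l * C / c) := by
  classical
  let w : Transmissions n k → ℝ≥0∞ := fun ω => if (numPending s ω : ℝ) ≤ M then 1 else 0
  have hiter : ∀ l' ≤ l, ∫⁻ ω, w ω * ENNReal.ofReal (φ (numPending (s + l') ω)) ∂law f ≤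
      ENNReal.ofReal (ρ ^ l' * C) := by
    intro l'
    induction l' with
    | zero =>
      intro _
      refine (lintegral_mono (g := fun _ => ENNReal.ofReal C) fun ω => ?_).trans (by simp)
      by_cases h : (numPending s ω : ℝ) ≤ M
      · simpa [w, h] using ENNReal.ofReal_le_ofReal (hC _ h)
      · simp [w, h]
    | succ l' ih =>
      intro hl'
      have hs : s ≤ s + l' := Nat.le_add_right _ _
      let W : ((u : Finset.Iic (s + l')) → Fin n → Fin (k + 1)) → ℝ≥0∞ := fun x =>
        if ((pendingSet (Preorder.frestrictLe₂ (π := fun _ => Fin n → Fin (k + 1)) hs x)).card : ℝ)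
          ≤ M then 1 else 0
      have key := lintegral_law_succ f (s + l') fun x y =>
        W x * ENNReal.ofReal (φ ((pendingSet x).filter fun i => ¬ Succeeds y i).card)
      have hL : ∫⁻ ω, w ω * ENNReal.ofReal (φ (numPending (s + (l' + 1)) ω)) ∂law f =
          ∫⁻ ω, W (Preorder.frestrictLe (s + l') ω) * ENNReal.ofReal
            (φ ((pendingSet (Preorder.frestrictLe (s + l') ω)).filter
              fun i => ¬ Succeeds (ω (s + l' + 1)) i).card) ∂law f := by
        refine lintegral_congr fun ω => ?_
        rw [← add_assoc, numPending, pendingSet_succ]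
        rfl
      rw [hL, key]
      calc _ ≤ ∫⁻ ω, ENNReal.ofReal ρ *
            (w ω * ENNReal.ofReal (φ (numPending (s + l') ω))) ∂law f := by
            refine lintegral_mono fun ω => ?_
            dsimp only
            rw [lintegral_const_mul _ Measurable.of_discrete]
            have hWw : W (Preorder.frestrictLe (s + l') ω) = w ω := rfl
            rw [hWw]
            by_cases h : (numPending s ω : ℝ) ≤ M
            · have hle : (numPending (s + l') ω : ℝ) ≤ M :=
                le_trans (by exact_mod_cast numPending_antitone ω hs) h
              simp only [w, h, if_true, one_mul]
              refine (lintegral_stepKernel_le f (s + l') ha hp0 hp1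
                (hf _ hs (by omega)) hφ hφ0 _ rfl).trans ?_
              rw [← ENNReal.ofReal_mul hρ]
              exact ENNReal.ofReal_le_ofReal (hdrift _ hle)
            · simp [w, h]
        _ = ENNReal.ofReal ρ *
            ∫⁻ ω, w ω * ENNReal.ofReal (φ (numPending (s + l') ω)) ∂law f :=
            lintegral_const_mul' _ _ ENNReal.ofReal_ne_top
        _ ≤ ENNReal.ofReal ρ * ENNReal.ofReal (ρ ^ l' * C) := by
            gcongr
            exact ih (by omega)
        _ = _ := by
            rw [← ENNReal.ofReal_mul hρ, pow_succ]
            ring_nf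
  have hw : Measurable w :=
    (Measurable.of_discrete (f := fun m : ℕ => if (m : ℝ) ≤ M then (1 : ℝ≥0∞) else 0)).comp
      (measurable_numPending s)
  have hmeas : Measurable fun ω => w ω * ENNReal.ofReal (φ (numPending (s + l) ω)) :=
    hw.mul ((Measurable.of_discrete (f := fun m : ℕ => ENNReal.ofReal (φ m))).comp
      (measurable_numPending (s + l)))
  rw [ENNReal.ofReal_div_of_pos hc]
  rw [ENNReal.le_div_iff_mul_le (Or.inl (by simpa using hc)) (Or.inl ENNReal.ofReal_ne_top),
    mul_comm]
  refine le_trans ?_ (hiter l le_rfl)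
  refine le_trans ?_ (mul_meas_ge_le_lintegral hmeas (ENNReal.ofReal c))
  refine mul_le_mul' le_rfl (measure_mono ?_)
  rintro ω ⟨h1, h2⟩
  simpa [w, h1] using ENNReal.ofReal_le_ofReal h2

/-! ### The intervals of `g₁` -/

/-- The last slot `l_1 + … + l_j` of the interval `I_j`. -/
noncomputable def endTime (β : ℝ) (k n j : ℕ) : ℕ :=
  ∑ i ∈ Finset.Icc 1 j, intervalLength β k n i

theorem endTime_succ (β : ℝ) (k n j : ℕ) :
    endTime β k n (j + 1) = endTime β k n j + intervalLength β k n (j + 1) :=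
  Finset.sum_Icc_succ_top (by omega) _

theorem endTime_mono (β : ℝ) (k n : ℕ) : Monotone (endTime β k n) :=
  monotone_nat_of_le_succ fun j => by rw [endTime_succ]; exact Nat.le_add_right _ _

theorem deadline_eq (β : ℝ) (k n : ℕ) :
    deadline β k n = 1 + endTime β k n (numIntervals β n + 1) := rfl

theorem intervalIndex_eq {β : ℝ} {k n j t : ℕ} (h1 : endTime β k n j ≤ t)
    (h2 : t < endTime β k n (j + 1)) : intervalIndex β k n (t + 1) = j + 1 := by
  have hmem : j + 1 ∈ {j | t + 1 ≤ ∑ i ∈ Finset.Icc 1 j, intervalLength β k n i} := h2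
  refine le_antisymm (Nat.sInf_le hmem) ?_
  by_contra hlt
  have hle : intervalIndex β k n (t + 1) ≤ j := by omega
  have hin : t + 1 ≤ endTime β k n (intervalIndex β k n (t + 1)) := Nat.sInf_mem ⟨_, hmem⟩
  have := hin.trans (endTime_mono β k n hle)
  omega

theorem g₁_apply {β : ℝ} {k n j t : ℕ} (hj : j ≤ numIntervals β n)
    (h1 : endTime β k n j ≤ t) (h2 : t < endTime β k n (j + 1))
    (hk : (k : ℝ) ≤ estimate β k n (j + 1)) (h : Fin t → Fin (k + 1)) {a : Fin (k + 1)}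
    (ha : a ≠ 0) : g₁ β k n t h a = ENNReal.ofReal (1 / estimate β k n (j + 1)) := by
  have hD : t + 1 < deadline β k n := by
    have := endTime_mono β k n (show j + 1 ≤ numIntervals β n + 1 by omega)
    rw [deadline_eq]
    omega
  rw [g₁, if_pos hD, channelStrategy_apply_of_ne_zero _ ha, intervalIndex_eq h1 h2, max_eq_left hk]

theorem estimate_mul {β : ℝ} {k n j : ℕ} (hk : 1 ≤ k) :
    estimate β k n j * k = β ^ j * n := by
  have : (k : ℝ) ≠ 0 := by positivity
  rw [estimate, div_mul_cancel₀ _ this]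

theorem one_le_pow_numIntervals_mul_sqrt {β : ℝ} (hβ0 : 0 < β) (hβ1 : β < 1) {n : ℕ} (hn : 1 ≤ n) :
    1 ≤ β ^ numIntervals β n * √n := by
  have hn' : (1 : ℝ) ≤ n := by exact_mod_cast hn
  have hlog : Real.logb β n ≤ 0 := by
    rw [Real.logb_nonpos_iff_of_base_lt_one hβ0 hβ1 (by linarith)]
    exact hn'
  have hr : (numIntervals β n : ℝ) ≤ -Real.logb β n / 2 := Nat.floor_le (by linarith)
  have h : (n : ℝ)⁻¹ ≤ (β ^ numIntervals β n) ^ 2 := by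
    rw [← pow_mul, ← Real.rpow_natCast, ← Real.rpow_logb hβ0 hβ1.ne (show (0 : ℝ) < n by linarith),
      ← Real.rpow_neg hβ0.le]
    refine Real.rpow_le_rpow_of_exponent_ge hβ0 hβ1.le ?_
    push_cast
    linarith
  refine (one_le_sq_iff₀ (by positivity)).1 ?_
  rw [mul_pow, Real.sq_sqrt (by positivity)]
  calc (1 : ℝ) = (n : ℝ)⁻¹ * n := by field_simp
    _ ≤ _ := by gcongr

theorem pow_numIntervals_succ_mul_sqrt_le_one {β : ℝ} (hβ0 : 0 < β) (hβ1 : β < 1) {n : ℕ}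
    (hn : 1 ≤ n) : β ^ (numIntervals β n + 1) * √n ≤ 1 := by
  have hn' : (1 : ℝ) ≤ n := by exact_mod_cast hn
  have hr : -Real.logb β n / 2 < (numIntervals β n : ℝ) + 1 := Nat.lt_floor_add_one _
  have h : (β ^ (numIntervals β n + 1)) ^ 2 ≤ (n : ℝ)⁻¹ := by
    rw [← pow_mul, ← Real.rpow_natCast, ← Real.rpow_logb hβ0 hβ1.ne (show (0 : ℝ) < n by linarith),
      ← Real.rpow_neg hβ0.le]
    refine Real.rpow_le_rpow_of_exponent_ge hβ0 hβ1.le ?_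
    push_cast
    linarith
  refine (sq_le_one_iff₀ (by positivity)).1 ?_
  rw [mul_pow, Real.sq_sqrt (by positivity)]
  calc _ ≤ (n : ℝ)⁻¹ * n := by gcongr
    _ = 1 := by field_simp

theorem numIntervals_le {β : ℝ} (hβ0 : 0 < β) (hβ1 : β < 1) {n : ℕ} (hn : 1 ≤ n) :
    (numIntervals β n : ℝ) ≤ (-Real.log β)⁻¹ * n := by
  have hn' : (1 : ℝ) ≤ n := by exact_mod_cast hn
  have hlogβ : 0 < -Real.log β := by linarith [Real.log_neg hβ0 hβ1]
  have hlogn : 0 ≤ Real.log n := Real.log_nonneg hn'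
  have hlogb : -Real.logb β n = (-Real.log β)⁻¹ * Real.log n := by
    rw [Real.logb, inv_neg, div_eq_inv_mul]
    ring
  have h0 : 0 ≤ (-Real.log β)⁻¹ * Real.log n := by positivity
  have hr : (numIntervals β n : ℝ) ≤ -Real.logb β n / 2 :=
    Nat.floor_le (by rw [hlogb]; positivity)
  calc (numIntervals β n : ℝ) ≤ (-Real.log β)⁻¹ * Real.log n := by rw [hlogb] at hr; linarith
    _ ≤ _ := by
      gcongr
      linarith [Real.log_le_sub_one_of_pos (show (0 : ℝ) < n by linarith)]

theorem deadline_bounds {β : ℝ} (hβ0 : 0 < β) (hβ1 : β < 1) {k n : ℕ} (hk : 1 ≤ k)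
    (hn : 2 * k + 1 ≤ n) :
    1 * ((n : ℝ) / k) ≤ deadline β k n ∧
      (deadline β k n : ℝ) ≤ (2 + Real.exp 1 / (β * (1 - β))) * ((n : ℝ) / k) := by
  have hk0 : (0 : ℝ) < k := by exact_mod_cast hk
  have hnk : (1 : ℝ) ≤ n / k := by
    rw [le_div_iff₀ hk0, one_mul]
    exact_mod_cast (by omega : k ≤ n)
  have hβ : 0 < 1 - β := by linarith
  set r := numIntervals β n with hr
  have hlast : intervalLength β k n (r + 1) = n / k := by simp [intervalLength, hr]
  have hD : (deadline β k n : ℝ) = 1 + endTime β k n r + (n / k : ℕ) := by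
    rw [deadline_eq, endTime_succ, ← hr, hlast]
    push_cast
    ring
  refine ⟨?_, ?_⟩
  · have h1 : (n : ℝ) / k ≤ (n / k : ℕ) + 1 := by
      rw [div_le_iff₀ hk0]
      exact_mod_cast (Nat.lt_mul_of_div_lt (Nat.lt_succ_self (n / k)) hk).le
    have h2 : (0 : ℝ) ≤ endTime β k n r := by positivity
    rw [hD]
    linarith
  · have h1 : ((n / k : ℕ) : ℝ) ≤ n / k := Nat.cast_div_le
    have h2 : (endTime β k n r : ℝ) ≤ Real.exp 1 / (β * (1 - β)) * (n / k) := by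
      have hgeom : ∑ i ∈ Finset.Icc 1 r, β ^ i ≤ (1 - β)⁻¹ := by
        refine (Finset.sum_le_sum_of_subset_of_nonneg (t := Finset.range (r + 1))
          (fun i hi => ?_) fun _ _ _ => by positivity).trans ?_
        · have := Finset.mem_Icc.1 hi
          exact Finset.mem_range.2 (by omega)
        · rw [← tsum_geometric_of_lt_one hβ0.le hβ1]
          exact (summable_geometric_of_lt_one hβ0.le hβ1).sum_le_tsum _
            fun _ _ => by positivity
      calc (endTime β k n r : ℝ) = ∑ i ∈ Finset.Icc 1 r, (intervalLength β k n i : ℝ) := by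
            rw [endTime]; push_cast; rfl
        _ ≤ ∑ i ∈ Finset.Icc 1 r, Real.exp 1 / β * (n / k) * β ^ i := by
            refine Finset.sum_le_sum fun i hi => ?_
            rw [intervalLength, if_pos (Finset.mem_Icc.1 hi).2]
            refine (Nat.floor_le (by unfold estimate; positivity)).trans (le_of_eq ?_)
            rw [estimate]
            ring
        _ ≤ Real.exp 1 / β * (n / k) * (1 - β)⁻¹ := by
            rw [← Finset.mul_sum]
            gcongr
        _ = _ := by
            field_simp
    rw [hD, add_mul]
    linarith

/-! ### One interval of `g₁` -/

/-- A lower bound for the probability that no other player transmits on a given channel, when the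
expected number of transmissions on it is at most `c`. -/
theorem exp_neg_le_one_sub_pow {p c : ℝ} (hp0 : 0 ≤ p) (hp : p ≤ 1 / 2) {m : ℕ} (hm : p * m ≤ c) :
    Real.exp (-(2 * c)) ≤ (1 - p) ^ (m - 1) := by
  have h1 : Real.exp (-(2 * p)) ≤ 1 - p := by
    rw [Real.exp_neg, inv_le_comm₀ (Real.exp_pos _) (by linarith)]
    refine le_trans ?_ (Real.add_one_le_exp _)
    rw [inv_le_iff_one_le_mul₀ (by linarith)]
    nlinarith
  calc Real.exp (-(2 * c)) ≤ Real.exp (m * -(2 * p)) := by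
        refine Real.exp_le_exp.2 ?_
        linarith
    _ = Real.exp (-(2 * p)) ^ m := Real.exp_nat_mul _ _
    _ ≤ (1 - p) ^ m := by gcongr
    _ ≤ (1 - p) ^ (m - 1) := pow_le_pow_of_le_one (by linarith) (by linarith) (Nat.sub_le _ _)

/-- If at most `β ^ j n` players are pending at the beginning of the interval `I_{j+1}`, where
`j < r`, then with high probability at most `β ^ (j + 1) n` are pending at its end.  The potential
is `exp N` on the event that the number `N` of pending players is still too large: its
expectation is multiplied by at most `1 - exp (-4 k) / 2` in every slot, and `hβk` makes this win
over the initial value `exp (β ^ j n)`. -/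
theorem measure_interval_le {β : ℝ} (hβ : 1 / 2 ≤ β) (hβ1 : β < 1) {k n j : ℕ} (hk : 1 ≤ k)
    (hβk : 2 * (1 - β) ≤ Real.exp (-(4 * k)) / (2 * k))
    (hj : j < numIntervals β n) (h2 : 2 ≤ estimate β k n (j + 1))
    (hkn : (k : ℝ) ≤ estimate β k n (j + 1)) :
    law (fun _ : Fin n => g₁ β k n) {ω | (numPending (endTime β k n j) ω : ℝ) ≤ β ^ j * n ∧
        ¬ (numPending (endTime β k n (j + 1)) ω : ℝ) ≤ β ^ (j + 1) * n} ≤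
      ENNReal.ofReal (Real.exp (1 - Real.exp (-(4 * k)) / (2 * k) * (β ^ (j + 1) * n))) := by
  have hβ0 : 0 < β := by linarith
  have hk1 : (1 : ℝ) ≤ k := by exact_mod_cast hk
  set q : ℝ := Real.exp (-(4 * k)) with hq
  have hq0 : 0 < q := Real.exp_pos _
  have hq1 : q ≤ 1 := Real.exp_le_one_iff.2 (by linarith)
  set e := estimate β k n (j + 1) with he
  have he0 : 0 < e := by linarith
  have hmul : e * k = β ^ (j + 1) * n := estimate_mul hk
  set m' : ℝ := β ^ (j + 1) * n with hm'
  have hm'0 : 0 < m' := by rw [← hmul]; positivity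
  have hM : β ^ j * n = m' / β := by
    rw [hm', pow_succ]
    field_simp
  set l := intervalLength β k n (j + 1) with hl
  have hp2 : 1 / e ≤ 1 / 2 := by gcongr
  let φ : ℕ → ℝ := fun m => if m' < m then Real.exp m else 0
  have hφ0 : ∀ m, 0 ≤ φ m := by
    intro m
    simp only [φ]
    split_ifs
    · positivity
    · rfl
  have hφ : Monotone φ := by
    intro a b hab
    have hab' : (a : ℝ) ≤ b := by exact_mod_cast hab
    simp only [φ]
    split_ifs with h h'
    · exact Real.exp_le_exp.2 hab'
    · linarith
    · positivity
    · rfl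
  have hdrift : ∀ m : ℕ, (m : ℝ) ≤ β ^ j * n →
      φ m - m * (1 / e) * (1 - 1 / e) ^ (m - 1) * (φ m - φ (m - 1)) ≤ (1 - q / 2) * φ m := by
    intro m hm
    by_cases hmm : m' < m
    · have hm1 : 1 ≤ m := by
        have : (0 : ℝ) < m := by linarith
        exact_mod_cast this
      have hφm : φ m = Real.exp m := if_pos hmm
      have hφm1 : φ (m - 1) ≤ Real.exp m / 2 := by
        simp only [φ]
        split_ifs
        · rw [Nat.cast_sub hm1, Nat.cast_one, Real.exp_sub]
          have : (2 : ℝ) ≤ Real.exp 1 := by linarith [Real.exp_one_gt_d9]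
          gcongr
        · positivity
      -- The expected number of transmissions on a channel is between `k` and `k / β ≤ 2 k`.
      have hpm : 1 / e * m ≤ 2 * k := by
        rw [hM] at hm
        calc 1 / e * m ≤ 1 / e * (m' / β) := by gcongr
          _ = k / β := by rw [← hmul]; field_simp
          _ ≤ 2 * k := by
            rw [div_le_iff₀ hβ0]
            nlinarith
      have hpm1 : 1 ≤ m * (1 / e) := by
        rw [mul_one_div, le_div_iff₀ he0]
        nlinarith
      have hQ : q ≤ m * (1 / e) * (1 - 1 / e) ^ (m - 1) := by
        have := exp_neg_le_one_sub_pow (by positivity) hp2 hpm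
        rw [show (2 : ℝ) * (2 * k) = 4 * k by ring] at this
        calc q ≤ 1 * (1 - 1 / e) ^ (m - 1) := by rw [one_mul]; exact this
          _ ≤ _ := by
            have : 0 ≤ 1 - 1 / e := by linarith
            gcongr
      have hpos := Real.exp_pos m
      rw [hφm]
      have : q * (Real.exp m / 2) ≤
          m * (1 / e) * (1 - 1 / e) ^ (m - 1) * (Real.exp m - φ (m - 1)) := by
        refine mul_le_mul hQ (by linarith) (by positivity) (hq0.le.trans hQ)
      linarith
    · have h1 : φ m = 0 := if_neg hmm
      have h2 : φ (m - 1) = 0 := le_antisymm (h1 ▸ hφ (Nat.sub_le m 1)) (hφ0 _)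
      rw [h1, h2]
      simp
  have hC : ∀ m : ℕ, (m : ℝ) ≤ β ^ j * n → φ m ≤ Real.exp (m' / β) := by
    intro m hm
    simp only [φ]
    split_ifs
    · exact Real.exp_le_exp.2 (hM ▸ hm)
    · positivity
  have hmain := measure_le_of_drift (fun _ : Fin n => g₁ β k n) (endTime β k n j) l
    (a := Fin.last k) (by simp [Fin.ext_iff]; omega) (p := 1 / e) (by positivity) (by linarith)
    (fun t ht1 ht2 _ h => g₁_apply hj.le ht1 (by rw [endTime_succ]; exact ht2) hkn h
      (by simp [Fin.ext_iff]; omega)) hφ hφ0 (by linarith) hdrift hC (Real.exp_pos m')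
  refine (measure_mono ?_).trans (hmain.trans (ENNReal.ofReal_le_ofReal ?_))
  · rintro ω ⟨h1, h2⟩
    refine ⟨h1, ?_⟩
    rw [← endTime_succ]
    have h2' := not_le.1 h2
    simp only [φ, h2', if_true]
    exact Real.exp_le_exp.2 h2'.le
  · have hl2 : 2 * e - 1 ≤ l := by
      have h1 : Real.exp 1 / β * e < l + 1 := by
        rw [hl, intervalLength, if_pos (by omega)]
        exact Nat.lt_floor_add_one _
      have h3 : (2 : ℝ) ≤ Real.exp 1 / β := by
        rw [le_div_iff₀ hβ0]
        linarith [Real.exp_one_gt_d9]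
      nlinarith
    have hpow : (1 - q / 2) ^ l ≤ Real.exp (l * -(q / 2)) := by
      rw [Real.exp_nat_mul]
      have : 0 ≤ 1 - q / 2 := by linarith
      gcongr
      linarith [Real.add_one_le_exp (-(q / 2))]
    have hgap : m' / β - m' ≤ 2 * (1 - β) * m' := by
      rw [div_sub' hβ0.ne', div_le_iff₀ hβ0]
      nlinarith [mul_pos hm'0 (sub_pos.2 hβ1)]
    have hgap2 : 2 * (1 - β) * m' ≤ q / (2 * k) * m' := by gcongr
    have hqe : q / (2 * k) * m' = q * e / 2 := by
      rw [← hmul]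
      field_simp
    calc (1 - q / 2) ^ l * Real.exp (m' / β) / Real.exp m'
        ≤ Real.exp (l * -(q / 2)) * Real.exp (m' / β) / Real.exp m' := by gcongr
      _ = Real.exp (l * -(q / 2) + m' / β - m') := by rw [Real.exp_sub, Real.exp_add]
      _ ≤ _ := by
        refine Real.exp_le_exp.2 ?_
        nlinarith

/-- If at most `β ^ r n` players are pending at the beginning of the last interval, then with high
probability none is pending at its end.  The potential is the number of pending players. -/
theorem measure_last_interval_le {β : ℝ} (hβ : 1 / 2 ≤ β) (hβ1 : β < 1) {k n : ℕ} (hk : 1 ≤ k)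
    (hn : 1 ≤ n) (h2 : 2 ≤ estimate β k n (numIntervals β n + 1))
    (hkn : (k : ℝ) ≤ estimate β k n (numIntervals β n + 1)) :
    law (fun _ : Fin n => g₁ β k n)
        {ω | (numPending (endTime β k n (numIntervals β n)) ω : ℝ) ≤ β ^ numIntervals β n * n ∧
          numPending (endTime β k n (numIntervals β n + 1)) ω ≠ 0} ≤
      ENNReal.ofReal (2 * √n * Real.exp (1 - Real.exp (-(4 * k)) * √n)) := by
  have hβ0 : 0 < β := by linarith
  have hk1 : (1 : ℝ) ≤ k := by exact_mod_cast hk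
  have hlow := pow_numIntervals_succ_mul_sqrt_le_one hβ0 hβ1 hn
  set r := numIntervals β n with hr
  set q : ℝ := Real.exp (-(4 * k)) with hq
  have hq0 : 0 < q := Real.exp_pos _
  have hq1 : q ≤ 1 := Real.exp_le_one_iff.2 (by linarith)
  set e := estimate β k n (r + 1) with he
  have he0 : 0 < e := by linarith
  have hmul : e * k = β ^ (r + 1) * n := estimate_mul hk
  have hs0 : 0 < √(n : ℝ) := Real.sqrt_pos.2 (by exact_mod_cast hn)
  have hss : √(n : ℝ) * √n = n := Real.mul_self_sqrt (by positivity)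
  have hek : e * k ≤ √n := by
    calc e * k = β ^ (r + 1) * √n * √n := by rw [hmul, mul_assoc, hss]
      _ ≤ √n := mul_le_of_le_one_left hs0.le hlow
  have hM : β ^ r * n = e * k / β := by
    rw [hmul, pow_succ]
    field_simp
  have hp2 : 1 / e ≤ 1 / 2 := by gcongr
  have hpq : 1 / e * q ≤ 1 := by nlinarith [show 0 < 1 / e by positivity]
  have hdrift : ∀ m : ℕ, (m : ℝ) ≤ β ^ r * n →
      (m : ℝ) - m * (1 / e) * (1 - 1 / e) ^ (m - 1) * ((m : ℝ) - (m - 1 : ℕ)) ≤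
        (1 - 1 / e * q) * m := by
    intro m hm
    rcases Nat.eq_zero_or_pos m with rfl | hm1
    · simp
    have hpm : 1 / e * m ≤ 2 * k := by
      rw [hM] at hm
      calc 1 / e * m ≤ 1 / e * (e * k / β) := by gcongr
        _ = k / β := by field_simp
        _ ≤ 2 * k := by
          rw [div_le_iff₀ hβ0]
          nlinarith
    have hQ := exp_neg_le_one_sub_pow (by positivity) hp2 hpm
    rw [show (2 : ℝ) * (2 * k) = 4 * k by ring, ← hq] at hQ
    have : (m : ℝ) * (1 / e) * q ≤ m * (1 / e) * (1 - 1 / e) ^ (m - 1) := by gcongr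
    rw [Nat.cast_sub hm1, Nat.cast_one]
    linarith
  have hmain := measure_le_of_drift (fun _ : Fin n => g₁ β k n) (endTime β k n r)
    (intervalLength β k n (r + 1))
    (a := Fin.last k) (by simp [Fin.ext_iff]; omega) (p := 1 / e) (by positivity) (by linarith)
    (fun t ht1 ht2 _ h => g₁_apply le_rfl ht1 (by rw [endTime_succ]; exact ht2) hkn h
      (by simp [Fin.ext_iff]; omega)) (φ := fun m => (m : ℝ)) Nat.mono_cast
    (fun m => Nat.cast_nonneg m) (by linarith) hdrift (C := β ^ r * n) (fun m hm => hm) one_pos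
  refine (measure_mono ?_).trans (hmain.trans (ENNReal.ofReal_le_ofReal ?_))
  · rintro ω ⟨h1, h2⟩
    refine ⟨h1, ?_⟩
    rw [← endTime_succ]
    exact_mod_cast Nat.one_le_iff_ne_zero.2 h2
  · have hl : intervalLength β k n (r + 1) = n / k := by simp [intervalLength, hr]
    have hl2 : (n : ℝ) / k - 1 ≤ (n / k : ℕ) := by
      have h1 : (n : ℝ) / k ≤ (n / k : ℕ) + 1 := by
        rw [div_le_iff₀ (by linarith)]
        exact_mod_cast (Nat.lt_mul_of_div_lt (Nat.lt_succ_self (n / k)) hk).le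
      linarith
    have hpl : √n - 1 ≤ 1 / e * (n / k : ℕ) := by
      have h1 : √n ≤ 1 / e * (n / k) := by
        rw [div_mul_div_comm, one_mul, le_div_iff₀ (by positivity)]
        calc √n * (e * k) ≤ √n * √n := by gcongr
          _ = n := hss
      have h3 : 1 / e * ((n : ℝ) / k - 1) ≤ 1 / e * (n / k : ℕ) := by gcongr
      linarith
    have hpow : (1 - 1 / e * q) ^ (n / k) ≤ Real.exp ((n / k : ℕ) * -(1 / e * q)) := by
      rw [Real.exp_nat_mul]
      have : 0 ≤ 1 - 1 / e * q := by linarith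
      gcongr
      linarith [Real.add_one_le_exp (-(1 / e * q))]
    have hM2 : β ^ r * n ≤ 2 * √n := by
      rw [hM, div_le_iff₀ hβ0]
      nlinarith
    rw [hl, div_one, mul_comm]
    refine mul_le_mul hM2 (hpow.trans (Real.exp_le_exp.2 ?_)) ?_ (by positivity)
    · nlinarith
    · exact pow_nonneg (by linarith) _

/-! ### Efficiency of `g₁` -/

theorem finishingTime_lt_of_numPending_eq_zero {n k t : ℕ} {ω : Transmissions n k}
    (h0 : ω 0 = fun _ => 0) (h : numPending t ω = 0) : finishingTime ω < ((t + 1 : ℕ) : ℕ∞) := by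
  refine lt_of_le_of_lt (b := (t : ℕ∞)) (iSup_le fun i => ?_) (by exact_mod_cast t.lt_succ_self)
  have hi : i ∉ pendingSet (Preorder.frestrictLe (π := fun _ => Fin n → Fin (k + 1)) t ω) := by
    rw [Finset.card_eq_zero.1 h]
    exact Finset.notMem_empty i
  rw [mem_pendingSet, not_not] at hi
  obtain ⟨⟨s, hst⟩, hs⟩ := hi
  have hs' : Succeeds (ω s) i := hs
  have hs1 : 1 ≤ s := by
    rcases Nat.eq_zero_or_pos s with rfl | h
    · exact absurd (by rw [h0]) hs'.1
    · exact h
  exact (iInf₂_le s ⟨hs1, hs'⟩).trans (by exact_mod_cast Finset.mem_Iic.1 hst)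

/-- The union bound over all intervals: the targets `β ^ j n` with `j ≤ r` are at least `√n`,
so that all error probabilities are exponentially small in `√n`. -/
theorem measure_numPending_ne_zero_le {β : ℝ} (hβ : 1 / 2 ≤ β) (hβ1 : β < 1) {k n : ℕ}
    (hk : 1 ≤ k) (hn : 1 ≤ n) (hβk : 2 * (1 - β) ≤ Real.exp (-(4 * k)) / (2 * k))
    (hs2 : 4 * (k : ℝ) ≤ √n) (hsk : 2 * (k : ℝ) * k ≤ √n) :
    law (fun _ : Fin n => g₁ β k n)
        {ω | numPending (endTime β k n (numIntervals β n + 1)) ω ≠ 0} ≤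
      ENNReal.ofReal ((numIntervals β n + 2 * √n) *
        Real.exp (1 - Real.exp (-(4 * k)) / (2 * k) * √n)) := by
  have hβ0 : 0 < β := by linarith
  have hk1 : (1 : ℝ) ≤ k := by exact_mod_cast hk
  have hup := one_le_pow_numIntervals_mul_sqrt hβ0 hβ1 hn
  set r := numIntervals β n with hr
  set q : ℝ := Real.exp (-(4 * k)) with hq
  have hq0 : 0 < q := Real.exp_pos _
  have hs0 : 0 < √(n : ℝ) := Real.sqrt_pos.2 (by exact_mod_cast hn)
  have hss : √(n : ℝ) * √n = n := Real.mul_self_sqrt (by positivity)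
  have hrn : √n ≤ β ^ r * n := by
    calc √n ≤ β ^ r * √n * √n := le_mul_of_one_le_left hs0.le hup
      _ = _ := by rw [mul_assoc, hss]
  have hpow : ∀ j ≤ r, √n ≤ β ^ j * n := fun j hj => hrn.trans <| by
    gcongr ?_ * _
    exact pow_le_pow_of_le_one hβ0.le hβ1.le hj
  have hest : ∀ j ≤ r, √n / 2 / k ≤ estimate β k n (j + 1) := by
    intro j hj
    rw [estimate, pow_succ]
    gcongr
    nlinarith [hpow j hj]
  have h2 : ∀ j ≤ r, 2 ≤ estimate β k n (j + 1) := fun j hj => le_trans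
    (by rw [div_div, le_div_iff₀ (by positivity)]; linarith) (hest j hj)
  have hkn : ∀ j ≤ r, (k : ℝ) ≤ estimate β k n (j + 1) := fun j hj => le_trans
    (by rw [div_div, le_div_iff₀ (by positivity)]; linarith) (hest j hj)
  let B : ℕ → Set (Transmissions n k) := fun j =>
    {ω | (numPending (endTime β k n j) ω : ℝ) ≤ β ^ j * n ∧
        ¬ (numPending (endTime β k n (j + 1)) ω : ℝ) ≤ β ^ (j + 1) * n}
  let L : Set (Transmissions n k) :=
    {ω | (numPending (endTime β k n r) ω : ℝ) ≤ β ^ r * n ∧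
          numPending (endTime β k n (r + 1)) ω ≠ 0}
  have hcover : {ω | numPending (endTime β k n (r + 1)) ω ≠ 0} ⊆
      (⋃ j ∈ Finset.range r, B j) ∪ L := by
    intro ω hω
    by_contra hnot
    rw [Set.mem_union, not_or] at hnot
    have hind : ∀ j ≤ r, (numPending (endTime β k n j) ω : ℝ) ≤ β ^ j * n := by
      intro j
      induction j with
      | zero =>
        intro _
        rw [pow_zero, one_mul]
        exact_mod_cast numPending_le _ ω
      | succ j ih =>
        intro hj
        by_contra hcon
        exact hnot.1 (Set.mem_iUnion₂.2 ⟨j, Finset.mem_range.2 hj, ih (by omega), hcon⟩)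
    exact hnot.2 ⟨hind r le_rfl, hω⟩
  have hE : 0 ≤ Real.exp (1 - q / (2 * k) * √n) := (Real.exp_pos _).le
  have hB : ∀ j ∈ Finset.range r, law (fun _ : Fin n => g₁ β k n) (B j) ≤
      ENNReal.ofReal (Real.exp (1 - q / (2 * k) * √n)) := by
    intro j hj
    have hj' := Finset.mem_range.1 hj
    refine (measure_interval_le hβ hβ1 hk hβk hj' (h2 j hj'.le) (hkn j hj'.le)).trans ?_
    refine ENNReal.ofReal_le_ofReal (Real.exp_le_exp.2 ?_)
    gcongr
    exact hpow (j + 1) hj'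
  have hL : law (fun _ : Fin n => g₁ β k n) L ≤
      ENNReal.ofReal (2 * √n * Real.exp (1 - q / (2 * k) * √n)) := by
    refine (measure_last_interval_le hβ hβ1 hk hn (h2 r le_rfl) (hkn r le_rfl)).trans ?_
    refine ENNReal.ofReal_le_ofReal ?_
    gcongr
    exact div_le_self hq0.le (by linarith)
  calc _ ≤ law (fun _ : Fin n => g₁ β k n) ((⋃ j ∈ Finset.range r, B j) ∪ L) :=
        measure_mono hcover
    _ ≤ law (fun _ : Fin n => g₁ β k n) (⋃ j ∈ Finset.range r, B j) +
        law (fun _ : Fin n => g₁ β k n) L := measure_union_le _ _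
    _ ≤ ∑ j ∈ Finset.range r, law (fun _ : Fin n => g₁ β k n) (B j) +
        law (fun _ : Fin n => g₁ β k n) L := by
        gcongr
        exact measure_biUnion_finset_le _ _
    _ ≤ ∑ _j ∈ Finset.range r, ENNReal.ofReal (Real.exp (1 - q / (2 * k) * √n)) +
        ENNReal.ofReal (2 * √n * Real.exp (1 - q / (2 * k) * √n)) :=
        add_le_add (Finset.sum_le_sum hB) hL
    _ = _ := by
        rw [Finset.sum_const, Finset.card_range, nsmul_eq_mul, ← ENNReal.ofReal_natCast,
          ← ENNReal.ofReal_mul (by positivity), ← ENNReal.ofReal_add (by positivity) (by positivity),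
          add_mul]

theorem tendsto_error_bound {A δ : ℝ} (hδ : 0 < δ) :
    Tendsto (fun n : ℕ => (A * n + 2 * √(n : ℝ)) * Real.exp (1 - δ * √n)) atTop (𝓝 0) := by
  have hs : Tendsto (fun n : ℕ => δ * √(n : ℝ)) atTop atTop :=
    (Real.tendsto_sqrt_atTop.comp tendsto_natCast_atTop_atTop).const_mul_atTop hδ
  have h2 := ((Real.tendsto_pow_mul_exp_neg_atTop_nhds_zero 2).comp hs).const_mul
    (A / δ ^ 2 * Real.exp 1)
  have h1 := ((Real.tendsto_pow_mul_exp_neg_atTop_nhds_zero 1).comp hs).const_mul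
    (2 / δ * Real.exp 1)
  have := h2.add h1
  rw [mul_zero, mul_zero, add_zero] at this
  refine this.congr fun n => ?_
  have hss : √(n : ℝ) ^ 2 = n := Real.sq_sqrt (by positivity)
  simp only [Function.comp_apply, mul_pow, pow_one, hss]
  rw [sub_eq_add_neg, Real.exp_add]
  field_simp

theorem tendsto_law_finishingTime_lt_deadline {β : ℝ} (hβ : 1 / 2 ≤ β) (hβ1 : β < 1) {k : ℕ}
    (hk : 1 ≤ k) (hβk : 2 * (1 - β) ≤ Real.exp (-(4 * k)) / (2 * k)) :
    Tendsto (fun n : ℕ => law (fun _ : Fin n => g₁ β k n)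
      {ω | finishingTime ω < (deadline β k n : ℕ∞)}) atTop (𝓝 1) := by
  have hβ0 : 0 < β := by linarith
  have hk0 : (0 : ℝ) < k := by exact_mod_cast hk
  have herr := ENNReal.tendsto_ofReal (tendsto_error_bound (A := (-Real.log β)⁻¹)
    (δ := Real.exp (-(4 * k)) / (2 * k)) (by positivity))
  rw [ENNReal.ofReal_zero] at herr
  have hlow := ENNReal.Tendsto.sub (tendsto_const_nhds (x := (1 : ℝ≥0∞))) herr
    (Or.inl ENNReal.one_ne_top)
  rw [tsub_zero] at hlow
  have hsqrt : Tendsto (fun n : ℕ => √(n : ℝ)) atTop atTop :=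
    Real.tendsto_sqrt_atTop.comp tendsto_natCast_atTop_atTop
  refine tendsto_of_tendsto_of_tendsto_of_le_of_le' hlow tendsto_const_nhds ?_
    (Eventually.of_forall fun n => prob_le_one)
  filter_upwards [hsqrt.eventually_ge_atTop (4 * (k : ℝ)),
    hsqrt.eventually_ge_atTop (2 * (k : ℝ) * k), eventually_ge_atTop 1] with n hn1 hn2 hn
  let S : Set (Transmissions n k) :=
    {ω | numPending (endTime β k n (numIntervals β n + 1)) ω ≠ 0}
  have hS : MeasurableSet S :=
    (measurable_numPending _) (MeasurableSet.of_discrete (s := {m : ℕ | m ≠ 0}))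
  have hbad : law (fun _ : Fin n => g₁ β k n) S ≤
      ENNReal.ofReal (((-Real.log β)⁻¹ * n + 2 * √n) *
        Real.exp (1 - Real.exp (-(4 * k)) / (2 * k) * √n)) := by
    refine (measure_numPending_ne_zero_le hβ hβ1 hk hn hβk hn1 hn2).trans ?_
    refine ENNReal.ofReal_le_ofReal ?_
    gcongr
    exact numIntervals_le hβ0 hβ1 hn
  calc _ ≤ 1 - law (fun _ : Fin n => g₁ β k n) S := tsub_le_tsub_left hbad _
    _ = law (fun _ : Fin n => g₁ β k n) Sᶜ := (prob_compl_eq_one_sub hS).symm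
    _ ≤ _ := by
      refine measure_mono_ae ?_
      filter_upwards [ae_law_zero (fun _ : Fin n => g₁ β k n)] with ω h0 hω
      have := finishingTime_lt_of_numPending_eq_zero h0 (not_not.1 hω)
      rwa [add_comm] at this

theorem isEfficient_of_tendsto {β : ℝ} (hβ0 : 0 < β) (hβ1 : β < 1) {k : ℕ} (hk : 1 ≤ k)
    (h : Tendsto (fun n : ℕ => law (fun _ : Fin n => g₁ β k n)
      {ω | finishingTime ω < (deadline β k n : ℕ∞)}) atTop (𝓝 1)) :
    IsEfficient k (g₁ β k) := by
  refine ⟨deadline β k, ⟨?_, ?_⟩, ?_⟩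
  · refine Asymptotics.IsBigO.of_bound (2 + Real.exp 1 / (β * (1 - β))) ?_
    filter_upwards [eventually_ge_atTop (2 * k + 1)] with n hn
    rw [Real.norm_of_nonneg (by positivity), Real.norm_of_nonneg (by positivity)]
    exact (deadline_bounds hβ0 hβ1 hk hn).2
  · refine Asymptotics.IsBigO.of_bound 1 ?_
    filter_upwards [eventually_ge_atTop (2 * k + 1)] with n hn
    rw [Real.norm_of_nonneg (by positivity), Real.norm_of_nonneg (by positivity), one_mul]
    simpa using (deadline_bounds hβ0 hβ1 hk hn).1
  · exact tendsto_of_tendsto_of_tendsto_of_le_of_le h tendsto_const_nhds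
      (fun n => measure_mono fun ω (hω : finishingTime ω < _) => hω.le) (fun n => prob_le_one)

end Contention

/-- For all `β ∈ (0, 1)`, `k ≥ 1` and `n ≥ 2 k + 1`, the protocol `g₁` is an equilibrium with
infinite expected latency, and its deadline `t₀` is `Θ(n / k)` with constants that depend on `β`
only.  For all `k ≥ 1` and all `β < 1` sufficiently close to `1` (in terms of `k`), the protocol is
efficient: all players transmit successfully before `t₀` with probability tending to `1`. -/
theorem mainTheorem6 :
    (∀ β : ℝ, 0 < β → β < 1 → ∀ k n : ℕ, 1 ≤ k → 2 * k + 1 ≤ n →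
      Contention.IsEquilibrium (fun _ : Fin n => Contention.g₁ β k n) ∧
      ∀ i : Fin n, Contention.expectedLatency (fun _ : Fin n => Contention.g₁ β k n) i = ⊤) ∧
    (∀ β : ℝ, 0 < β → β < 1 → ∃ c C : ℝ, 0 < c ∧ 0 < C ∧
      ∀ k n : ℕ, 1 ≤ k → 2 * k + 1 ≤ n →
        c * ((n : ℝ) / k) ≤ Contention.deadline β k n ∧
        (Contention.deadline β k n : ℝ) ≤ C * ((n : ℝ) / k)) ∧
    (∀ k : ℕ, 1 ≤ k → ∃ β₀ : ℝ, 0 < β₀ ∧ β₀ < 1 ∧ ∀ β : ℝ, β₀ < β → β < 1 →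
      Contention.IsEfficient k (Contention.g₁ β k) ∧
      Tendsto (fun n : ℕ => Contention.law (fun _ : Fin n => Contention.g₁ β k n)
        {ω | Contention.finishingTime ω < (Contention.deadline β k n : ℕ∞)}) atTop (𝓝 1)) := by
  refine ⟨fun β _ _ k n hk hn => ⟨Contention.isEquilibrium_g₁ hk hn,
    Contention.expectedLatency_eq_top hk hn⟩, fun β hβ0 hβ1 => ?_, fun k hk => ?_⟩
  · have : 0 < 1 - β := by linarith
    exact ⟨1, 2 + Real.exp 1 / (β * (1 - β)), one_pos, by positivity,
      fun k n hk hn => Contention.deadline_bounds hβ0 hβ1 hk hn⟩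
  · have hk0 : (0 : ℝ) < k := by exact_mod_cast hk
    -- `β` is so close to `1` that the `(1 - β) β ^ j n` successes required in `I_{j+1}` are only a
    -- fraction of those expected when every slot is successful with probability `exp (-4 k)`.
    refine ⟨max (1 / 2) (1 - Real.exp (-(4 * k)) / (2 * k) / 2), by positivity,
      max_lt (by norm_num) (sub_lt_self _ (by positivity)), fun β hβ hβ1 => ?_⟩
    obtain ⟨hβ2, hβk⟩ := max_lt_iff.1 hβ
    have h := Contention.tendsto_law_finishingTime_lt_deadline hβ2.le hβ1 hk (by linarith)
    exact ⟨Contention.isEfficient_of_tendsto (by linarith) hβ1 hk h, h⟩
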